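/- Let $L^2(0,1)$ be the Hilbert space of complex-valued square-integrable functions on $(0,1)$ and let $\mathcal{H}_1$ be the finite Hardy operator on $L^2(0,1)$, $(\mathcal{H}_1 f)(x)=\frac1x\int_0^x f(t)\,dt$ for $0<x<1$, which is bounded, with adjoint $\mathcal{H}_1^*$. Put $T=I-\mathcal{H}_1^*$ and let $\chi\equiv 1$ on $(0,1)$. A vector $v$ is a frame vector for a bounded operator $T$ on a Hilbert space $H$ if there are constants $c_1,c_2>0$ with $$c_1\|x\|^2\le\sum_{n=0}^\infty|\langle x,T^nv\rangle|^2\le c_2\|x\|^2\qquad\text{for all }x\in H.$$ Let $H^\infty$ be the algebra of bounded analytic functions on the open unit disk $\mathbb{D}$. For $\psi(z)=\sum_{n\ge0}a_nz^n$ in $H^\infty$, the operator $\psi(T)$ is defined by the $H^\infty$ functional calculus, that is, $\psi(T)x=\lim_{r\to1^-}\psi(rT)x$ for every $x\in L^2(0,1)$, where $\psi(rT)=\sum_{n\ge0}a_nr^nT^n$ (absolutely convergent in operator norm for $0\le r<1$). Then $\psi(T)$ exists as a bounded operator on $L^2(0,1)$ for every $\psi\in H^\infty$, and a function $f\in L^2(0,1)$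 is a frame vector for $T=I-\mathcal{H}_1^*$ if and only if there is a $\psi\in H^\infty$, without zeros in $\mathbb{D}$ and with $1/\psi\in H^\infty$, such that $f=\psi(I-\mathcal{H}_1^*)\chi$. -/

import Mathlib

open MeasureTheory Set Filter Topology
open scoped ENNReal InnerProductSpace InnerProduct

noncomputable section

/-- The Lebesgue space `L²(0,1)` of complex-valued functions. -/
abbrev L2Unit : Type := Lp ℂ 2 ((volume : Measure ℝ).restrict (Ioo (0 : ℝ) 1))

/-- The function `x ↦ (1/x) ∫₀ˣ g(t) dt`. -/
def hardyAverage (g : ℝ → ℂ) (x : ℝ) : ℂ := (x : ℂ)⁻¹ * ∫ t in (0 : ℝ)..x, g t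

section HardyInequality

theorem lintegral_rpow_neg_half {x : ℝ} (hx : 0 < x) :
    ∫⁻ t in Ioc (0 : ℝ) x, ENNReal.ofReal (t ^ (-(1 / 2) : ℝ)) =
      ENNReal.ofReal (2 * x ^ (1 / 2 : ℝ)) := by
  have hi : IntegrableOn (fun t : ℝ => t ^ (-(1 / 2) : ℝ)) (Ioc 0 x) := by
    have := intervalIntegral.intervalIntegrable_rpow' (a := 0) (b := x) (r := -(1 / 2))
      (by norm_num)
    rwa [intervalIntegrable_iff_integrableOn_Ioc_of_le hx.le] at this
  rw [← ofReal_integral_eq_lintegral_ofReal hi, ← intervalIntegral.integral_of_le hx.le,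
    integral_rpow (Or.inl (by norm_num))]
  · congr 1
    norm_num
    ring
  · filter_upwards [ae_restrict_mem measurableSet_Ioc] with t ht
    exact Real.rpow_nonneg ht.1.le _

theorem lintegral_rpow_neg_three_half {t : ℝ} (ht : 0 < t) (ht1 : t < 1) :
    ∫⁻ x in Ioc t 1, ENNReal.ofReal (2 * x ^ (-(3 / 2) : ℝ)) ≤
      ENNReal.ofReal (4 * t ^ (-(1 / 2) : ℝ)) := by
  have h0 : (0 : ℝ) ∉ uIcc t 1 := by
    rw [uIcc_of_le ht1.le]; exact fun h => absurd h.1 (not_le.2 ht)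
  have hi : IntegrableOn (fun x : ℝ => 2 * x ^ (-(3 / 2) : ℝ)) (Ioc t 1) := by
    have := (intervalIntegral.intervalIntegrable_rpow (μ := volume) (a := t) (b := 1)
      (r := -(3 / 2)) (Or.inr h0)).const_mul 2
    rwa [intervalIntegrable_iff_integrableOn_Ioc_of_le ht1.le] at this
  rw [← ofReal_integral_eq_lintegral_ofReal hi, ← intervalIntegral.integral_of_le ht1.le,
    intervalIntegral.integral_const_mul, integral_rpow (Or.inr ⟨by norm_num, h0⟩)]
  · apply ENNReal.ofReal_le_ofReal
    norm_num
    linarith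
  · filter_upwards [ae_restrict_mem measurableSet_Ioc] with x hx
    have := Real.rpow_nonneg (ht.trans hx.1).le (-(3 / 2))
    simpa using this

theorem enorm_hardyAverage_sq_le {g : ℝ → ℂ} (hg : StronglyMeasurable g) {x : ℝ} (hx : 0 < x) :
    ‖hardyAverage g x‖ₑ ^ 2 ≤ ENNReal.ofReal (2 * x ^ (-(3 / 2) : ℝ)) *
      ∫⁻ t in Ioc (0 : ℝ) x, ‖g t‖ₑ ^ 2 * ENNReal.ofReal (t ^ (1 / 2 : ℝ)) := by
  have h1 : ‖∫ t in (0 : ℝ)..x, g t‖ₑ ≤ ∫⁻ t in Ioc (0 : ℝ) x, ‖g t‖ₑ := by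
    rw [intervalIntegral.integral_of_le hx.le]
    exact enorm_integral_le_lintegral_enorm _
  have h2 : ∫⁻ t in Ioc (0 : ℝ) x, ‖g t‖ₑ =
      ∫⁻ t in Ioc (0 : ℝ) x, ((fun t => ‖g t‖ₑ * ENNReal.ofReal (t ^ (1 / 4 : ℝ))) *
        fun t => ENNReal.ofReal (t ^ (-(1 / 4) : ℝ))) t := by
    refine setLIntegral_congr_fun measurableSet_Ioc fun t ht => ?_
    simp only [Pi.mul_apply]
    rw [mul_assoc, ← ENNReal.ofReal_mul (Real.rpow_nonneg ht.1.le _), ← Real.rpow_add ht.1]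
    simp
  have hgm : Measurable fun t => ‖g t‖ₑ := hg.measurable.enorm
  have hpow : ∀ s : ℝ, Measurable fun t : ℝ => ENNReal.ofReal (t ^ s) := fun s => by fun_prop
  have h3 := ENNReal.lintegral_mul_le_Lp_mul_Lq (volume.restrict (Ioc (0 : ℝ) x))
    Real.HolderConjugate.two_two
    (f := fun t => ‖g t‖ₑ * ENNReal.ofReal (t ^ (1 / 4 : ℝ)))
    (g := fun t => ENNReal.ofReal (t ^ (-(1 / 4) : ℝ)))
    (hgm.mul (hpow _)).aemeasurable (hpow _).aemeasurable
  rw [← h2] at h3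
  have h4 : (∫⁻ t in Ioc (0 : ℝ) x, ‖g t‖ₑ) ^ 2 ≤
      (∫⁻ t in Ioc (0 : ℝ) x, ‖g t‖ₑ ^ 2 * ENNReal.ofReal (t ^ (1 / 2 : ℝ))) *
        ENNReal.ofReal (2 * x ^ (1 / 2 : ℝ)) := by
    refine (pow_le_pow_left' h3 2).trans_eq ?_
    rw [mul_pow, ← lintegral_rpow_neg_half hx]
    congr 1
    · rw [← ENNReal.rpow_natCast, ← ENNReal.rpow_mul]
      norm_num
      refine setLIntegral_congr_fun measurableSet_Ioc fun t ht => ?_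
      rw [mul_pow, ← ENNReal.ofReal_pow (Real.rpow_nonneg ht.1.le _), ← Real.rpow_natCast,
        ← Real.rpow_mul ht.1.le]
      norm_num
    · rw [← ENNReal.rpow_natCast, ← ENNReal.rpow_mul]
      norm_num
      refine setLIntegral_congr_fun measurableSet_Ioc fun t ht => ?_
      rw [← ENNReal.ofReal_pow (Real.rpow_nonneg ht.1.le _), ← Real.rpow_natCast,
        ← Real.rpow_mul ht.1.le]
      norm_num
  have h5 : ‖(x : ℂ)⁻¹‖ₑ = ENNReal.ofReal (x ^ (-1 : ℝ)) := by
    rw [← ofReal_norm, norm_inv, Complex.norm_real, Real.norm_of_nonneg hx.le,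
      Real.rpow_neg_one]
  calc ‖hardyAverage g x‖ₑ ^ 2
      = ENNReal.ofReal (x ^ (-1 : ℝ)) ^ 2 * ‖∫ t in (0 : ℝ)..x, g t‖ₑ ^ 2 := by
        rw [hardyAverage, enorm_mul, mul_pow, h5]
    _ ≤ ENNReal.ofReal (x ^ (-1 : ℝ)) ^ 2 *
        ((∫⁻ t in Ioc (0 : ℝ) x, ‖g t‖ₑ ^ 2 * ENNReal.ofReal (t ^ (1 / 2 : ℝ))) *
        ENNReal.ofReal (2 * x ^ (1 / 2 : ℝ))) := by
        gcongr
        exact (pow_le_pow_left' h1 2).trans h4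
    _ = _ := by
        rw [mul_comm (∫⁻ _ in _, _), ← mul_assoc, ← ENNReal.ofReal_pow (by positivity),
          ← ENNReal.ofReal_mul (by positivity)]
        congr 2
        rw [← Real.rpow_natCast, ← Real.rpow_mul hx.le, mul_left_comm, ← Real.rpow_add hx]
        norm_num

theorem lintegral_hardyAverage_sq_le {g : ℝ → ℂ} (hg : StronglyMeasurable g) :
    ∫⁻ x in Ioo (0 : ℝ) 1, ‖hardyAverage g x‖ₑ ^ 2 ≤
      4 * ∫⁻ t in Ioo (0 : ℝ) 1, ‖g t‖ₑ ^ 2 := by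
  have hgm : Measurable fun t => ‖g t‖ₑ := hg.measurable.enorm
  set G : ℝ → ℝ≥0∞ := fun t => ‖g t‖ₑ ^ 2 * ENNReal.ofReal (t ^ (1 / 2 : ℝ)) with hG
  have hGm : Measurable G := by fun_prop
  set F : ℝ → ℝ≥0∞ := fun x => ENNReal.ofReal (2 * x ^ (-(3 / 2) : ℝ)) with hF
  have hFm : Measurable F := by fun_prop
  set K : ℝ → ℝ → ℝ≥0∞ := fun x t =>
    {p : ℝ × ℝ | p.2 ≤ p.1}.indicator (fun p => F p.1 * G p.2) (x, t) with hK
  have hKm : Measurable (Function.uncurry K) := by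
    have : Measurable fun p : ℝ × ℝ => F p.1 * G p.2 := by fun_prop
    exact this.indicator (measurableSet_le measurable_snd measurable_fst)
  calc ∫⁻ x in Ioo (0 : ℝ) 1, ‖hardyAverage g x‖ₑ ^ 2
      ≤ ∫⁻ x in Ioo (0 : ℝ) 1, ∫⁻ t in Ioo (0 : ℝ) 1, K x t := by
        refine setLIntegral_mono' measurableSet_Ioo fun x hx => ?_
        refine (enorm_hardyAverage_sq_le hg hx.1).trans ?_
        rw [← lintegral_const_mul _ hGm]
        have hsub : Ioc (0 : ℝ) x ⊆ Ioo 0 1 := fun t ht => ⟨ht.1, ht.2.trans_lt hx.2⟩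
        refine le_trans (le_of_eq ?_) (lintegral_mono_set hsub)
        refine setLIntegral_congr_fun measurableSet_Ioc fun t ht => ?_
        simp [hK, hF, indicator, ht.2]
    _ = ∫⁻ t in Ioo (0 : ℝ) 1, ∫⁻ x in Ioo (0 : ℝ) 1, K x t :=
        lintegral_lintegral_swap hKm.aemeasurable
    _ ≤ ∫⁻ t in Ioo (0 : ℝ) 1, 4 * ‖g t‖ₑ ^ 2 := by
        refine setLIntegral_mono' measurableSet_Ioo fun t ht => ?_
        have e1 : ∫⁻ x in Ioo (0 : ℝ) 1, K x t ≤ ∫⁻ x in Icc t 1, F x * G t := by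
          rw [← lintegral_indicator measurableSet_Ioo, ← lintegral_indicator measurableSet_Icc]
          refine lintegral_mono fun x => ?_
          by_cases hx : x ∈ Ioo (0 : ℝ) 1
          · by_cases htx : t ≤ x
            · simp [hK, indicator, hx.1, hx.2, hx.2.le, htx]
            · simp [hK, indicator, htx]
          · rw [indicator_of_notMem hx]; exact zero_le
        refine e1.trans ?_
        rw [lintegral_mul_const _ hFm, restrict_Ioc_eq_restrict_Icc.symm]
        calc (∫⁻ x in Ioc t 1, F x) * G t
            ≤ ENNReal.ofReal (4 * t ^ (-(1 / 2) : ℝ)) * G t := by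
              gcongr
              exact lintegral_rpow_neg_three_half ht.1 ht.2
          _ = 4 * ‖g t‖ₑ ^ 2 := by
              rw [hG]
              dsimp only
              rw [mul_left_comm, ← ENNReal.ofReal_mul
                (mul_nonneg (by norm_num) (Real.rpow_nonneg ht.1.le _)), mul_assoc,
                ← Real.rpow_add ht.1, mul_comm]
              norm_num
    _ = 4 * ∫⁻ t in Ioo (0 : ℝ) 1, ‖g t‖ₑ ^ 2 := lintegral_const_mul _ (by fun_prop)

theorem intervalIntegrable_L2Unit (f : L2Unit) {x : ℝ} (hx : x ∈ Ioo (0 : ℝ) 1) :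
    IntervalIntegrable f volume 0 x := by
  have h : IntegrableOn f (Ioo (0 : ℝ) 1) := (Lp.memLp f).integrable (by norm_num)
  rw [intervalIntegrable_iff_integrableOn_Ioc_of_le hx.1.le]
  exact h.mono_set fun t ht => ⟨ht.1, ht.2.trans_lt hx.2⟩

theorem eLpNorm_hardyAverage_le (f : L2Unit) :
    eLpNorm (hardyAverage f) 2 (volume.restrict (Ioo (0 : ℝ) 1)) ≤
      2 * eLpNorm f 2 (volume.restrict (Ioo (0 : ℝ) 1)) := by
  have h := lintegral_hardyAverage_sq_le (Lp.stronglyMeasurable f)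
  have h2 : (2 : ℝ≥0∞) = (4 : ℝ≥0∞) ^ (1 / 2 : ℝ) := by
    rw [show (4 : ℝ≥0∞) = 2 ^ (2 : ℝ) by norm_num, ← ENNReal.rpow_mul]
    norm_num
  rw [eLpNorm_eq_lintegral_rpow_enorm_toReal (by norm_num) (by norm_num),
    eLpNorm_eq_lintegral_rpow_enorm_toReal (by norm_num) (by norm_num)]
  simp only [ENNReal.toReal_ofNat, ENNReal.rpow_ofNat]
  refine (ENNReal.rpow_le_rpow h (by norm_num : (0 : ℝ) ≤ 1 / 2)).trans_eq ?_
  rw [ENNReal.mul_rpow_of_nonneg _ _ (by norm_num), ← h2]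

theorem memLp_hardyAverage (f : L2Unit) :
    MemLp (hardyAverage f) 2 (volume.restrict (Ioo (0 : ℝ) 1)) := by
  refine ⟨?_, (eLpNorm_hardyAverage_le f).trans_lt
    (ENNReal.mul_lt_top (by norm_num) (Lp.eLpNorm_lt_top f))⟩
  have h : IntegrableOn f (uIcc (0 : ℝ) 1) := by
    have h : IntegrableOn f (Ioo (0 : ℝ) 1) := (Lp.memLp f).integrable (by norm_num)
    rwa [uIcc_of_le zero_le_one, integrableOn_Icc_iff_integrableOn_Ioo]
  have hc := (intervalIntegral.continuousOn_primitive_interval h).mono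
    (Ioo_subset_Icc_self.trans (uIcc_of_le zero_le_one).ge)
  have hinv : Measurable fun x : ℝ => (x : ℂ)⁻¹ := by fun_prop
  exact hinv.aestronglyMeasurable.mul (hc.aestronglyMeasurable measurableSet_Ioo)

end HardyInequality

/-- The finite Hardy operator `(H₁ f)(x) = (1/x) ∫₀ˣ f(t) dt` as a bounded operator
on `L²(0,1)`. -/
def hardyOperator : L2Unit →L[ℂ] L2Unit :=
  LinearMap.mkContinuous
    { toFun := fun f => (memLp_hardyAverage f).toLp (hardyAverage f)
      map_add' := fun f g => by
        rw [← MemLp.toLp_add, MemLp.toLp_eq_toLp_iff]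
        have hfg := ae_imp_of_ae_restrict (Lp.coeFn_add f g)
        filter_upwards [ae_restrict_mem measurableSet_Ioo] with x hx
        have : ∫ t in (0 : ℝ)..x, (f + g : L2Unit) t = ∫ t in (0 : ℝ)..x, (f t + g t) := by
          refine intervalIntegral.integral_congr_ae ?_
          filter_upwards [hfg] with t ht htx
          rw [uIoc_of_le hx.1.le] at htx
          exact ht ⟨htx.1, htx.2.trans_lt hx.2⟩
        simp only [hardyAverage, Pi.add_apply]
        rw [this, intervalIntegral.integral_add (intervalIntegrable_L2Unit f hx)
          (intervalIntegrable_L2Unit g hx), mul_add]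
      map_smul' := fun c f => by
        rw [RingHom.id_apply, ← MemLp.toLp_const_smul, MemLp.toLp_eq_toLp_iff]
        have hcf := ae_imp_of_ae_restrict (Lp.coeFn_smul c f)
        filter_upwards [ae_restrict_mem measurableSet_Ioo] with x hx
        have : ∫ t in (0 : ℝ)..x, (c • f : L2Unit) t = ∫ t in (0 : ℝ)..x, c • f t := by
          refine intervalIntegral.integral_congr_ae ?_
          filter_upwards [hcf] with t ht htx
          rw [uIoc_of_le hx.1.le] at htx
          exact ht ⟨htx.1, htx.2.trans_lt hx.2⟩
        simp only [hardyAverage, Pi.smul_apply]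
        rw [this, intervalIntegral.integral_smul, smul_eq_mul, smul_eq_mul, mul_left_comm] }
    2 (fun f => by
      simp only [LinearMap.coe_mk, AddHom.coe_mk]
      rw [Lp.norm_toLp, Lp.norm_def]
      have := ENNReal.toReal_mono
        (ENNReal.mul_ne_top (by norm_num) (Lp.eLpNorm_ne_top f)) (eLpNorm_hardyAverage_le f)
      rwa [ENNReal.toReal_mul, ENNReal.toReal_ofNat] at this)

/-- The constant function `χ ≡ 1` in `L²(0,1)`. -/
def chiUnit : L2Unit := Lp.const 2 ((volume : Measure ℝ).restrict (Ioo (0 : ℝ) 1)) (1 : ℂ)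

/-- `v` is a frame vector for `T`: the orbit `(Tⁿ v)` is a frame. -/
def IsFrameVector {H : Type*} [NormedAddCommGroup H] [InnerProductSpace ℂ H]
    (T : H →L[ℂ] H) (v : H) : Prop :=
  ∃ c₁ c₂ : ℝ, 0 < c₁ ∧ 0 < c₂ ∧ ∀ x : H,
    Summable (fun n : ℕ => ‖⟪x, (T ^ n) v⟫_ℂ‖ ^ 2) ∧
    c₁ * ‖x‖ ^ 2 ≤ ∑' n : ℕ, ‖⟪x, (T ^ n) v⟫_ℂ‖ ^ 2 ∧
    ∑' n : ℕ, ‖⟪x, (T ^ n) v⟫_ℂ‖ ^ 2 ≤ c₂ * ‖x‖ ^ 2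

/-- `ψ` restricts to an element of `H^∞`, i.e. it is holomorphic and bounded on the open unit
disk. Values outside the disk are irrelevant. -/
def MemHInfty (ψ : ℂ → ℂ) : Prop :=
  DifferentiableOn ℂ ψ (Metric.ball 0 1) ∧ ∃ C : ℝ, ∀ z ∈ Metric.ball (0 : ℂ) 1, ‖ψ z‖ ≤ C

/-- The `n`-th Taylor coefficient of `ψ` at the origin. -/
def taylorCoeffZero (ψ : ℂ → ℂ) (n : ℕ) : ℂ := iteratedDeriv n ψ 0 / (n.factorial : ℂ)

/-- The operator `A` is the value `ψ(T)` of the `H^∞` functional calculus: with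
`ψ(z) = ∑ aₙ zⁿ`, for each `0 ≤ r < 1` the series `ψ(rT) = ∑ aₙ rⁿ Tⁿ` converges absolutely in
operator norm, and `ψ(rT) → A` in the strong operator topology as `r → 1⁻`. -/
def IsHInftyValue {H : Type*} [NormedAddCommGroup H] [InnerProductSpace ℂ H]
    (ψ : ℂ → ℂ) (T A : H →L[ℂ] H) : Prop :=
  (∀ r : ℝ, 0 ≤ r → r < 1 →
    Summable fun n : ℕ => ‖(taylorCoeffZero ψ n * (r : ℂ) ^ n) • T ^ n‖) ∧
  ∀ x : H, Tendsto
    (fun r : ℝ => (∑' n : ℕ, (taylorCoeffZero ψ n * (r : ℂ) ^ n) • T ^ n) x)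
    (𝓝[<] (1 : ℝ)) (𝓝 (A x))

open Classical in
/-- The operator `ψ(T)` of the `H^∞` functional calculus (`0` if it does not exist). -/
def hInftyCalculus {H : Type*} [NormedAddCommGroup H] [InnerProductSpace ℂ H]
    (ψ : ℂ → ℂ) (T : H →L[ℂ] H) : H →L[ℂ] H :=
  if h : ∃ A : H →L[ℂ] H, IsHInftyValue ψ T A then h.choose else 0

end

/-! Put `T = I - H₁*`. The monomials `xᵏ` are eigenfunctions of the Hardy operator with eigenvalue
`1/(k+1)`, and their positive powers are already complete in `L²(0,1)`. Computing with them shows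
that `T* T = I` and `T* χ = 0`, and that the orbit of `χ` spans a dense subspace. So that orbit is
an orthonormal basis (`hardyShiftBasis`), and `T` is the unilateral shift of multiplicity one.

For a shift on a basis `b`, let `k_w` be the reproducing kernel at `w` in the disk. Pairing with
`k_w` represents the space as power series and turns `ψ(T)` into multiplication by `ψ(w)`
(`inner_szegoKernel_hInftyCalculus`). The calculus exists because the dilations `ψ(rT)` are
uniformly bounded by von Neumann's inequality and converge on the basis.

If `f` is a frame vector, the frame inequalities tested on `k_w` bound `|⟪k_w, f⟫|` above and below,
so `ψ(w) = ⟪k_w, f⟫` is invertible in `H^∞`. Conversely, for invertible `ψ` the orbit of `ψ(T) b₀`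
is the image of the basis under an operator with a bounded right inverse, hence a frame
(`isFrameVector_shift_iff`). -/

noncomputable section


/-! ### Von Neumann's inequality for the shift, through multiplication operators on the circle. -/

section Shift

variable {H : Type*} [NormedAddCommGroup H] [InnerProductSpace ℂ H]

/-- Multiplication by a continuous function as a bounded operator on `L²` of the circle. -/
def circleMul : C(AddCircle (1 : ℝ), ℂ) →L[ℂ]
    (Lp ℂ 2 (AddCircle.haarAddCircle (T := 1))) →L[ℂ] Lp ℂ 2 (AddCircle.haarAddCircle (T := 1)) :=
  ((ContinuousLinearMap.mul ℂ ℂ).holderL AddCircle.haarAddCircle ∞ 2 2).comp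
    (ContinuousMap.toLp ∞ AddCircle.haarAddCircle ℂ)

theorem norm_circleMul_le (g : C(AddCircle (1 : ℝ), ℂ)) : ‖circleMul g‖ ≤ ‖g‖ := by
  refine ContinuousLinearMap.opNorm_le_bound _ (norm_nonneg _) fun f => ?_
  have h1 : ‖ContinuousMap.toLp (E := ℂ) ∞ (AddCircle.haarAddCircle (T := 1)) ℂ g‖ ≤ ‖g‖ := by
    have h := (ContinuousMap.toLp (E := ℂ) ∞ (AddCircle.haarAddCircle (T := 1)) ℂ).le_of_opNorm_le
      (ContinuousMap.toLp_norm_le (p := ∞) (E := ℂ) (𝕜 := ℂ) (AddCircle.haarAddCircle (T := 1))) g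
    simpa using h
  have h2 := ContinuousLinearMap.norm_holder_apply_apply_le (r := 2) (ContinuousLinearMap.mul ℂ ℂ)
    (ContinuousMap.toLp (E := ℂ) ∞ (AddCircle.haarAddCircle (T := 1)) ℂ g) f
  rw [ContinuousLinearMap.opNorm_mul, one_mul] at h2
  exact h2.trans (by gcongr)

theorem circleMul_fourier_fourierLp (m n : ℤ) :
    circleMul (fourier m) (fourierLp 2 n) = fourierLp 2 (m + n) := by
  refine Lp.ext ?_
  refine (ContinuousLinearMap.coeFn_holder (r := 2) (ContinuousLinearMap.mul ℂ ℂ) _ _).trans ?_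
  filter_upwards [ContinuousMap.coeFn_toLp (p := ∞) (𝕜 := ℂ)
    (AddCircle.haarAddCircle (T := 1)) (fourier m), coeFn_fourierLp (T := 1) 2 n,
    coeFn_fourierLp (T := 1) 2 (m + n)] with x h1 h2 h3
  refine (congrArg₂ (fun a c : ℂ => a * c) h1 h2).trans ?_
  rw [h3, fourier_add]

theorem HilbertBasis.continuousLinearMap_ext {ι F : Type*} [NormedAddCommGroup F]
    [NormedSpace ℂ F] (b : HilbertBasis ι ℂ H) {A B : H →L[ℂ] F}
    (h : ∀ i, A (b i) = B (b i)) : A = B := by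
  refine ContinuousLinearMap.ext_on (s := Set.range b) ?_ ?_
  · rw [dense_iff_closure_eq, ← Submodule.topologicalClosure_coe, b.dense_span]; rfl
  · rintro _ ⟨i, rfl⟩; exact h i

theorem orthonormal_fourierLp_nat :
    Orthonormal ℂ fun n : ℕ => fourierLp (T := 1) 2 (n : ℤ) :=
  orthonormal_fourier.comp _ Nat.cast_injective

/-- The isometry that identifies the basis `b` with the analytic trigonometric monomials. -/
def hardyEmbedding (b : HilbertBasis ℕ ℂ H) :
    H →ₗᵢ[ℂ] Lp ℂ 2 (AddCircle.haarAddCircle (T := 1)) :=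
  orthonormal_fourierLp_nat.orthogonalFamily.linearIsometry.comp b.repr.toLinearIsometry

theorem hardyEmbedding_basis (b : HilbertBasis ℕ ℂ H) (n : ℕ) :
    hardyEmbedding b (b n) = fourierLp 2 (n : ℤ) := by
  classical
  have h : hardyEmbedding b (b n) = orthonormal_fourierLp_nat.orthogonalFamily.linearIsometry
    (b.repr (b n)) := rfl
  rw [h, b.repr_self, OrthogonalFamily.linearIsometry_apply_single]
  simp

variable {T : H →L[ℂ] H} {b : HilbertBasis ℕ ℂ H}

theorem shift_pow_basis (hT : ∀ n, T (b n) = b (n + 1)) (n m : ℕ) :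
    (T ^ n) (b m) = b (m + n) := by
  induction n generalizing m with
  | zero => simp
  | succ n ih =>
    rw [pow_succ, mul_apply_eq_comp, hT, ih]; congr 1; omega

/-- Both sides are continuous and linear in `x`, and on a basis vector both raise the frequency by
`n`. -/
theorem hardyEmbedding_shift_pow (hT : ∀ n, T (b n) = b (n + 1)) (n : ℕ) (x : H) :
    hardyEmbedding b ((T ^ n) x) = circleMul (fourier (n : ℤ)) (hardyEmbedding b x) := by
  have h : (hardyEmbedding b).toContinuousLinearMap.comp (T ^ n) =
      (circleMul (fourier (n : ℤ))).comp (hardyEmbedding b).toContinuousLinearMap := by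
    refine b.continuousLinearMap_ext fun m => ?_
    simp only [ContinuousLinearMap.comp_apply, LinearIsometry.coe_toContinuousLinearMap]
    rw [shift_pow_basis hT, hardyEmbedding_basis, hardyEmbedding_basis,
      circleMul_fourier_fourierLp]
    push_cast; rw [add_comm]
  exact DFunLike.congr_fun h x

theorem norm_shift_pow_le (hT : ∀ n, T (b n) = b (n + 1)) (n : ℕ) : ‖T ^ n‖ ≤ 1 := by
  refine ContinuousLinearMap.opNorm_le_bound _ zero_le_one fun x => ?_
  rw [← (hardyEmbedding b).norm_map, hardyEmbedding_shift_pow hT,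
    ← (hardyEmbedding b).norm_map x]
  refine (circleMul _).le_of_opNorm_le ((norm_circleMul_le _).trans ?_) _
  rw [fourier_norm]

theorem summable_norm_smul_shift_pow (hT : ∀ n, T (b n) = b (n + 1)) {c : ℕ → ℂ}
    (hc : Summable fun n => ‖c n‖) : Summable fun n => ‖c n • T ^ n‖ := by
  refine Summable.of_nonneg_of_le (fun _ => norm_nonneg _) (fun n => ?_) hc
  rw [norm_smul]
  exact mul_le_of_le_one_right (norm_nonneg _) (norm_shift_pow_le hT n)

/-- Von Neumann's inequality for the unilateral shift and absolutely convergent power series. -/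
theorem norm_tsum_smul_shift_pow_le [CompleteSpace H] (hT : ∀ n, T (b n) = b (n + 1)) {c : ℕ → ℂ}
    (hc : Summable fun n => ‖c n‖) {C : ℝ} (hC : ∀ z : ℂ, ‖z‖ = 1 → ‖∑' n, c n * z ^ n‖ ≤ C) :
    ‖∑' n, c n • T ^ n‖ ≤ C := by
  have hC0 : 0 ≤ C := (norm_nonneg _).trans (hC 1 (by simp))
  have hs : Summable fun n : ℕ => c n • fourier (T := 1) (n : ℤ) := by
    refine Summable.of_norm ?_
    simpa [norm_smul, fourier_norm] using hc
  have hg : ‖∑' n : ℕ, c n • fourier (T := 1) (n : ℤ)‖ ≤ C := by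
    refine (ContinuousMap.norm_le _ hC0).2 fun x => ?_
    rw [← ContinuousMap.tsum_apply hs]
    have hx : ∀ n : ℕ, (c n • fourier (n : ℤ)) x = c n * (AddCircle.toCircle x : ℂ) ^ n :=
      fun n => by simp [fourier_apply, AddCircle.toCircle_nsmul]
    simp only [hx]
    exact hC _ (Circle.norm_coe _)
  refine ContinuousLinearMap.opNorm_le_bound _ hC0 fun x => ?_
  -- The isometric embedding carries the operator series to multiplication by the symbol `∑ cₙ zⁿ`,
  -- whose sup norm on the circle bounds the operator norm.
  have key : hardyEmbedding b ((∑' n, c n • T ^ n) x) =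
      circleMul (∑' n : ℕ, c n • fourier (T := 1) (n : ℤ)) (hardyEmbedding b x) := by
    have h1 := ((summable_norm_smul_shift_pow hT hc).of_norm.hasSum.mapL
      (ContinuousLinearMap.apply ℂ H x)).mapL (hardyEmbedding b).toContinuousLinearMap
    have h2 := (hs.hasSum.mapL circleMul).mapL (ContinuousLinearMap.apply ℂ _ (hardyEmbedding b x))
    refine h1.unique ?_
    refine h2.congr_fun fun n => ?_
    simp only [ContinuousLinearMap.apply_apply, map_smul, LinearIsometry.coe_toContinuousLinearMap, hardyEmbedding_shift_pow hT]
  rw [← (hardyEmbedding b).norm_map, key, ← (hardyEmbedding b).norm_map x]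
  exact (circleMul _).le_of_opNorm_le ((norm_circleMul_le _).trans hg) _

end Shift


/-! ### Hilbert bases: Parseval, coefficients, strong convergence. -/

section HilbertBasisLemmas

variable {H : Type*} [NormedAddCommGroup H] [InnerProductSpace ℂ H] (b : HilbertBasis ℕ ℂ H)

theorem HilbertBasis.hasSum_norm_inner_sq (x : H) :
    HasSum (fun n => ‖⟪b n, x⟫_ℂ‖ ^ 2) (‖x‖ ^ 2) := by
  have h := (b.hasSum_inner_mul_inner x x).mapL Complex.reCLM
  have e : Complex.reCLM ⟪x, x⟫_ℂ = ‖x‖ ^ 2 := inner_self_eq_norm_sq (𝕜 := ℂ) x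
  rw [e] at h
  refine h.congr_fun fun n => ?_
  rw [← inner_conj_symm x (b n), Complex.reCLM_apply, ← Complex.normSq_eq_conj_mul_self,
    Complex.ofReal_re, Complex.normSq_eq_norm_sq]

theorem HilbertBasis.inner_eq_of_hasSum {c : ℕ → ℂ} {x : H}
    (h : HasSum (fun n => c n • b n) x) (n : ℕ) : ⟪b n, x⟫_ℂ = c n := by
  have h1 := h.mapL (innerSL ℂ (b n))
  refine h1.unique ?_
  have h2 := hasSum_ite_eq n (c n)
  refine h2.congr_fun fun m => ?_
  rw [innerSL_apply_apply, inner_smul_right, orthonormal_iff_ite.1 b.orthonormal n m]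
  by_cases hm : m = n
  · simp [hm]
  · simp [hm, Ne.symm hm]

theorem HilbertBasis.ext_inner {x y : H} (h : ∀ n, ⟪b n, x⟫_ℂ = ⟪b n, y⟫_ℂ) : x = y := by
  refine b.repr.injective (lp.ext (funext fun n => ?_))
  rw [b.repr_apply_apply, b.repr_apply_apply, h]

/-- A net of uniformly bounded operators that converges on a Hilbert basis converges
pointwise. -/
theorem HilbertBasis.exists_tendsto_of_basis {ι F : Type*} [NormedAddCommGroup F]
    [NormedSpace ℂ F] [CompleteSpace F] {l : Filter ι} [l.NeBot] {B : ι → H →L[ℂ] F} {C : ℝ}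
    (hB : ∀ᶠ i in l, ‖B i‖ ≤ C)
    (hb : ∀ n, ∃ y, Tendsto (fun i => B i (b n)) l (𝓝 y)) (x : H) :
    ∃ y, Tendsto (fun i => B i x) l (𝓝 y) := by
  have hspan : ∀ s ∈ Submodule.span ℂ (Set.range b), ∃ y, Tendsto (fun i => B i s) l (𝓝 y) := by
    intro s hs
    induction hs using Submodule.span_induction with
    | mem s hs => obtain ⟨n, rfl⟩ := hs; exact hb n
    | zero => exact ⟨0, by simp⟩
    | add s t _ _ hs ht =>
      obtain ⟨y, hy⟩ := hs
      obtain ⟨z, hz⟩ := ht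
      exact ⟨y + z, by simpa using hy.add hz⟩
    | smul c s _ hs =>
      obtain ⟨y, hy⟩ := hs
      exact ⟨c • y, by simpa using hy.const_smul c⟩
  have hC : 0 ≤ C := by
    obtain ⟨i, hi⟩ := hB.exists
    exact (norm_nonneg _).trans hi
  rw [← cauchy_map_iff_exists_tendsto, Metric.cauchy_iff]
  refine ⟨inferInstance, fun ε hε => ?_⟩
  have hx : x ∈ closure (Submodule.span ℂ (Set.range b) : Set H) := by
    rw [← Submodule.topologicalClosure_coe, b.dense_span]; trivial
  -- The uniform bound makes the error from replacing `x` by `s` at most `ε / 4`; `C + 1` avoids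
  -- division by zero when `C = 0`.
  obtain ⟨s, hs, hxs⟩ := Metric.mem_closure_iff.1 hx (ε / (4 * (C + 1))) (by positivity)
  obtain ⟨y, hy⟩ := hspan s hs
  have hclose : ∀ᶠ i in l, dist (B i x) y < ε / 2 := by
    filter_upwards [hB, (Metric.tendsto_nhds.1 hy) (ε / 4) (by positivity)] with i hi1 hi2
    have h1 : dist (B i x) (B i s) ≤ ε / 4 := by
      rw [dist_eq_norm, ← map_sub]
      refine ((B i).le_of_opNorm_le hi1 _).trans ?_
      rw [dist_eq_norm] at hxs
      calc C * ‖x - s‖ ≤ (C + 1) * (ε / (4 * (C + 1))) := by gcongr; linarith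
        _ = ε / 4 := by field_simp
    linarith [dist_triangle (B i x) (B i s) y]
  refine ⟨Metric.ball y (ε / 2), hclose, fun u hu v hv => ?_⟩
  rw [Metric.mem_ball] at hu hv
  linarith [dist_triangle_right u v y]

end HilbertBasisLemmas

/-! ### The reproducing kernel and the power series model of `H`. -/

section SzegoKernel

variable {H : Type*} [NormedAddCommGroup H] [InnerProductSpace ℂ H]

/-- The reproducing kernel `∑ w̄ⁿ bₙ` at the point `w` of the unit disk. -/
def szegoKernel (b : HilbertBasis ℕ ℂ H) (w : ℂ) : H := ∑' n, (starRingEnd ℂ w) ^ n • b n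

variable {b : HilbertBasis ℕ ℂ H}

theorem hasSum_szegoKernel [CompleteSpace H] {w : ℂ} (hw : ‖w‖ < 1) :
    HasSum (fun n => (starRingEnd ℂ w) ^ n • b n) (szegoKernel b w) := by
  refine Summable.hasSum (Summable.of_norm ?_)
  simpa [norm_smul, b.orthonormal.1] using summable_geometric_of_lt_one (norm_nonneg w) hw

theorem inner_szegoKernel_basis [CompleteSpace H] {w : ℂ} (hw : ‖w‖ < 1) (n : ℕ) :
    ⟪szegoKernel b w, b n⟫_ℂ = w ^ n := by
  rw [← inner_conj_symm, b.inner_eq_of_hasSum (hasSum_szegoKernel hw)]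
  simp

theorem hasSum_inner_szegoKernel [CompleteSpace H] {w : ℂ} (hw : ‖w‖ < 1) (x : H) :
    HasSum (fun n => ⟪b n, x⟫_ℂ * w ^ n) ⟪szegoKernel b w, x⟫_ℂ := by
  refine (b.hasSum_inner_mul_inner (szegoKernel b w) x).congr_fun fun n => ?_
  rw [inner_szegoKernel_basis hw, mul_comm]

theorem hasFPowerSeriesOnBall_inner_szegoKernel [CompleteSpace H] (x : H) :
    HasFPowerSeriesOnBall (fun w => ⟪szegoKernel b w, x⟫_ℂ)
      (FormalMultilinearSeries.ofScalars ℂ fun n => ⟪b n, x⟫_ℂ) 0 1 where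
  r_le := by
    refine FormalMultilinearSeries.le_radius_of_bound (r := 1) _ ‖x‖ fun n => ?_
    rw [FormalMultilinearSeries.ofScalars_norm]
    simpa [b.orthonormal.1] using norm_inner_le_norm (𝕜 := ℂ) (b n) x
  r_pos := one_pos
  hasSum := fun {y} hy => by
    have hy' : ‖y‖ < 1 := by
      have := hy
      rw [Metric.mem_eball, edist_zero_right, ← ofReal_norm, ENNReal.ofReal_lt_one] at this
      exact this
    rw [zero_add]
    refine (hasSum_inner_szegoKernel hy' x).congr_fun fun n => ?_
    simp [mul_comm]

theorem differentiableOn_inner_szegoKernel [CompleteSpace H] (x : H) :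
    DifferentiableOn ℂ (fun w => ⟪szegoKernel b w, x⟫_ℂ) (Metric.ball 0 1) := by
  have h := (hasFPowerSeriesOnBall_inner_szegoKernel (b := b) x).differentiableOn
  rwa [← ENNReal.coe_one, Metric.eball_coe] at h

/-- The pairing with `k_w` is the power series in `w` whose coefficients are those of the vector in
the basis, so uniqueness of power series applies. -/
theorem ext_inner_szegoKernel [CompleteSpace H] {x y : H}
    (h : ∀ w : ℂ, ‖w‖ < 1 → ⟪szegoKernel b w, x⟫_ℂ = ⟪szegoKernel b w, y⟫_ℂ) : x = y := by
  have h1 := (hasFPowerSeriesOnBall_inner_szegoKernel (b := b) x).hasFPowerSeriesAt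
  have h2 := (hasFPowerSeriesOnBall_inner_szegoKernel (b := b) y).hasFPowerSeriesAt
  have he : (fun w => ⟪szegoKernel b w, x⟫_ℂ) =ᶠ[𝓝 0] fun w => ⟪szegoKernel b w, y⟫_ℂ := by
    filter_upwards [Metric.ball_mem_nhds (0 : ℂ) one_pos] with w hw
    exact h w (by simpa using hw)
  have h3 := (h1.congr he).eq_formalMultilinearSeries h2
  refine b.ext_inner fun n => ?_
  exact congrFun (FormalMultilinearSeries.ofScalars_series_injective ℂ ℂ h3) n

/-- This says that `k_w` is an eigenvector of the adjoint shift; it suffices to check basis vectors,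
where `⟪k_w, b m⟫ = wᵐ`. -/
theorem inner_szegoKernel_shift_pow [CompleteSpace H] {T : H →L[ℂ] H}
    (hT : ∀ n, T (b n) = b (n + 1)) {w : ℂ} (hw : ‖w‖ < 1) (n : ℕ) (x : H) :
    ⟪szegoKernel b w, (T ^ n) x⟫_ℂ = w ^ n * ⟪szegoKernel b w, x⟫_ℂ := by
  have h : (innerSL ℂ (szegoKernel b w)).comp (T ^ n) = w ^ n • innerSL ℂ (szegoKernel b w) := by
    refine b.continuousLinearMap_ext fun m => ?_
    simp only [ContinuousLinearMap.comp_apply, innerSL_apply_apply, FunLike.coe_smul,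
      Pi.smul_apply, smul_eq_mul]
    rw [shift_pow_basis hT, inner_szegoKernel_basis hw, inner_szegoKernel_basis hw]
    ring
  exact DFunLike.congr_fun h x

end SzegoKernel


/-! ### The `H^∞` calculus of a shift and its frame vectors. -/

section FunctionalCalculus

theorem hasSum_taylorCoeffZero {ψ : ℂ → ℂ} (hψ : DifferentiableOn ℂ ψ (Metric.ball 0 1)) {z : ℂ}
    (hz : ‖z‖ < 1) : HasSum (fun n => taylorCoeffZero ψ n * z ^ n) (ψ z) := by
  have h := Complex.hasSum_taylorSeries_on_ball (r := 1) (c := 0) (z := z) (f := ψ)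
    (by simpa using hψ) (by simpa using hz)
  refine h.congr_fun fun n => ?_
  simp only [taylorCoeffZero, sub_zero, smul_eq_mul]
  ring

theorem summable_norm_taylorCoeffZero {ψ : ℂ → ℂ}
    (hψ : DifferentiableOn ℂ ψ (Metric.ball 0 1)) {r : ℝ} (hr0 : 0 ≤ r) (hr : r < 1) :
    Summable fun n => ‖taylorCoeffZero ψ n * (r : ℂ) ^ n‖ := by
  refine (hasSum_taylorCoeffZero hψ (z := (r : ℂ)) ?_).summable.norm
  rwa [Complex.norm_real, Real.norm_of_nonneg hr0]

theorem Ioo_zero_one_mem_nhdsLT_one : Ioo (0 : ℝ) 1 ∈ 𝓝[<] (1 : ℝ) :=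
  Ioo_mem_nhdsLT zero_lt_one

variable {H : Type*} [NormedAddCommGroup H] [InnerProductSpace ℂ H]

/-- The operator `ψ(rT) = ∑ aₙ rⁿ Tⁿ`. -/
def hInftyDilation (ψ : ℂ → ℂ) (T : H →L[ℂ] H) (r : ℝ) : H →L[ℂ] H :=
  ∑' n : ℕ, (taylorCoeffZero ψ n * (r : ℂ) ^ n) • T ^ n

variable [CompleteSpace H] {T : H →L[ℂ] H} {b : HilbertBasis ℕ ℂ H} {ψ : ℂ → ℂ}

theorem hasSum_hInftyDilation (hT : ∀ n, T (b n) = b (n + 1))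
    (hψ : DifferentiableOn ℂ ψ (Metric.ball 0 1)) {r : ℝ} (hr0 : 0 ≤ r) (hr : r < 1) :
    HasSum (fun n => (taylorCoeffZero ψ n * (r : ℂ) ^ n) • T ^ n) (hInftyDilation ψ T r) :=
  (summable_norm_smul_shift_pow hT (summable_norm_taylorCoeffZero hψ hr0 hr)).of_norm.hasSum

/-- The symbol of the dilation on the unit circle is `z ↦ ψ(rz)`, and `rz` lies in the open disk, so
von Neumann's inequality gives a bound independent of `r`. -/
theorem norm_hInftyDilation_le (hT : ∀ n, T (b n) = b (n + 1))
    (hψ : DifferentiableOn ℂ ψ (Metric.ball 0 1)) {C : ℝ}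
    (hC : ∀ z ∈ Metric.ball (0 : ℂ) 1, ‖ψ z‖ ≤ C) {r : ℝ} (hr0 : 0 ≤ r) (hr : r < 1) :
    ‖hInftyDilation ψ T r‖ ≤ C := by
  refine norm_tsum_smul_shift_pow_le hT (summable_norm_taylorCoeffZero hψ hr0 hr) fun z hz => ?_
  have hrz : ‖(r : ℂ) * z‖ < 1 := by
    rwa [norm_mul, hz, mul_one, Complex.norm_real, Real.norm_of_nonneg hr0]
  have h := (hasSum_taylorCoeffZero hψ hrz).tsum_eq
  simp only [mul_pow, ← mul_assoc] at h
  rw [h]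
  exact hC _ (by simpa using hrz)

theorem inner_basis_hInftyDilation (hT : ∀ n, T (b n) = b (n + 1))
    (hψ : DifferentiableOn ℂ ψ (Metric.ball 0 1)) {r : ℝ} (hr0 : 0 ≤ r) (hr : r < 1) (n : ℕ) :
    ⟪b n, hInftyDilation ψ T r (b 0)⟫_ℂ = taylorCoeffZero ψ n * (r : ℂ) ^ n := by
  refine b.inner_eq_of_hasSum (c := fun n => taylorCoeffZero ψ n * (r : ℂ) ^ n) ?_ n
  refine ((hasSum_hInftyDilation hT hψ hr0 hr).mapL
    (ContinuousLinearMap.apply ℂ H (b 0))).congr_fun fun n => ?_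
  rw [map_smul, ContinuousLinearMap.apply_apply, shift_pow_basis hT, zero_add]

/-- Bessel's inequality for `ψ(rT) b₀` bounds each finite sum of `|aₙ rⁿ|²` by `C²`; then `r → 1`.
-/
theorem summable_norm_sq_taylorCoeffZero (hT : ∀ n, T (b n) = b (n + 1)) (hψ : MemHInfty ψ) :
    Summable fun n => ‖taylorCoeffZero ψ n‖ ^ 2 := by
  obtain ⟨hd, C, hC⟩ := hψ
  refine summable_of_sum_le (c := C ^ 2) (fun n => by positivity) fun s => ?_
  have hlim : Tendsto (fun r : ℝ => ∑ n ∈ s, ‖taylorCoeffZero ψ n * (r : ℂ) ^ n‖ ^ 2)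
      (𝓝[<] (1 : ℝ)) (𝓝 (∑ n ∈ s, ‖taylorCoeffZero ψ n‖ ^ 2)) := by
    have hc : Continuous fun r : ℝ => ∑ n ∈ s, ‖taylorCoeffZero ψ n * (r : ℂ) ^ n‖ ^ 2 := by
      fun_prop
    simpa using (hc.tendsto 1).mono_left nhdsWithin_le_nhds
  refine le_of_tendsto hlim ?_
  filter_upwards [Ioo_zero_one_mem_nhdsLT_one] with r hr
  calc ∑ n ∈ s, ‖taylorCoeffZero ψ n * (r : ℂ) ^ n‖ ^ 2
      = ∑ n ∈ s, ‖⟪b n, hInftyDilation ψ T r (b 0)⟫_ℂ‖ ^ 2 := by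
        simp only [inner_basis_hInftyDilation hT hd hr.1.le hr.2]
    _ ≤ ‖hInftyDilation ψ T r (b 0)‖ ^ 2 := b.orthonormal.sum_inner_products_le _
    _ ≤ C ^ 2 := by
        gcongr
        refine ((hInftyDilation ψ T r).le_of_opNorm_le
          (norm_hInftyDilation_le hT hd hC hr.1.le hr.2) _).trans_eq ?_
        rw [b.orthonormal.1, mul_one]

/-- The limit is `∑ aₙ bₙ`. By Parseval the squared distance to it is `∑ |aₙ rⁿ - aₙ|²`, which tends
to zero by dominated convergence with majorant `|aₙ|²`. -/
theorem exists_tendsto_hInftyDilation_basis_zero (hT : ∀ n, T (b n) = b (n + 1))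
    (hψ : MemHInfty ψ) :
    ∃ y, Tendsto (fun r => hInftyDilation ψ T r (b 0)) (𝓝[<] (1 : ℝ)) (𝓝 y) := by
  have hs := summable_norm_sq_taylorCoeffZero hT hψ
  have hmem : Memℓp (taylorCoeffZero ψ) 2 := memℓp_gen (by simpa using hs)
  set y : H := b.repr.symm ⟨taylorCoeffZero ψ, hmem⟩ with hy
  have hyn : ∀ n, ⟪b n, y⟫_ℂ = taylorCoeffZero ψ n := fun n => by
    rw [← b.repr_apply_apply, hy, LinearIsometryEquiv.apply_symm_apply]
  refine ⟨y, ?_⟩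
  have hsq : Tendsto (fun r : ℝ => ∑' n, ‖taylorCoeffZero ψ n * (r : ℂ) ^ n -
      taylorCoeffZero ψ n‖ ^ 2) (𝓝[<] (1 : ℝ)) (𝓝 (∑' _ : ℕ, (0 : ℝ))) := by
    refine tendsto_tsum_of_dominated_convergence hs (fun n => ?_) ?_
    · have hc : Continuous fun r : ℝ => ‖taylorCoeffZero ψ n * (r : ℂ) ^ n -
        taylorCoeffZero ψ n‖ ^ 2 := by fun_prop
      simpa using (hc.tendsto 1).mono_left nhdsWithin_le_nhds
    · filter_upwards [Ioo_zero_one_mem_nhdsLT_one] with r hr n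
      rw [Real.norm_of_nonneg (by positivity)]
      have h1 : ‖(r : ℂ) ^ n - 1‖ ≤ 1 := by
        have h2 : (r : ℂ) ^ n - 1 = ((r ^ n - 1 : ℝ) : ℂ) := by push_cast; ring
        have h3 := pow_le_one₀ hr.1.le hr.2.le (n := n)
        have h4 := pow_nonneg hr.1.le n
        rw [h2, Complex.norm_real, Real.norm_eq_abs, abs_le]
        constructor <;> linarith
      calc ‖taylorCoeffZero ψ n * (r : ℂ) ^ n - taylorCoeffZero ψ n‖ ^ 2
          = (‖taylorCoeffZero ψ n‖ * ‖(r : ℂ) ^ n - 1‖) ^ 2 := by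
            rw [← norm_mul, mul_sub, mul_one]
        _ ≤ (‖taylorCoeffZero ψ n‖ * 1) ^ 2 := by gcongr
        _ = _ := by rw [mul_one]
  rw [tsum_zero] at hsq
  rw [tendsto_iff_norm_sub_tendsto_zero]
  have hsqrt := hsq.sqrt
  rw [Real.sqrt_zero] at hsqrt
  refine hsqrt.congr' ?_
  filter_upwards [Ioo_zero_one_mem_nhdsLT_one] with r hr
  have h := (b.hasSum_norm_inner_sq (hInftyDilation ψ T r (b 0) - y)).tsum_eq
  simp only [inner_sub_right, hyn, inner_basis_hInftyDilation hT hψ.1 hr.1.le hr.2] at h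
  rw [h, Real.sqrt_sq (norm_nonneg _)]

/-- Dilations commute with powers of `T`. This transfers convergence at `b 0` to every basis vector.
-/
theorem hInftyDilation_basis (hT : ∀ n, T (b n) = b (n + 1))
    (hψ : DifferentiableOn ℂ ψ (Metric.ball 0 1)) {r : ℝ} (hr0 : 0 ≤ r) (hr : r < 1) (k : ℕ) :
    hInftyDilation ψ T r (b k) = (T ^ k) (hInftyDilation ψ T r (b 0)) := by
  have h := hasSum_hInftyDilation hT hψ hr0 hr
  have hc : hInftyDilation ψ T r * T ^ k = T ^ k * hInftyDilation ψ T r := by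
    refine (h.mul_right (T ^ k)).unique ((h.mul_left (T ^ k)).congr_fun fun n => ?_)
    rw [smul_mul_assoc, mul_smul_comm, ← pow_add, ← pow_add, add_comm]
  have h2 := DFunLike.congr_fun hc (b 0)
  rwa [mul_apply_eq_comp, mul_apply_eq_comp, shift_pow_basis hT, zero_add] at h2

/-- The `H^∞` functional calculus of a unilateral shift exists. -/
theorem exists_isHInftyValue_shift (hT : ∀ n, T (b n) = b (n + 1)) (hψ : MemHInfty ψ) :
    ∃ A : H →L[ℂ] H, IsHInftyValue ψ T A := by
  obtain ⟨C, hC⟩ := hψ.2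
  have hlim : ∀ x : H, ∃ y, Tendsto (fun r => hInftyDilation ψ T r x) (𝓝[<] (1 : ℝ)) (𝓝 y) := by
    refine b.exists_tendsto_of_basis (C := C) ?_ fun k => ?_
    · filter_upwards [Ioo_zero_one_mem_nhdsLT_one] with r hr
      exact norm_hInftyDilation_le hT hψ.1 hC hr.1.le hr.2
    · obtain ⟨y, hy⟩ := exists_tendsto_hInftyDilation_basis_zero hT hψ
      refine ⟨(T ^ k) y, (((T ^ k).continuous.tendsto y).comp hy).congr' ?_⟩
      filter_upwards [Ioo_zero_one_mem_nhdsLT_one] with r hr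
      exact (hInftyDilation_basis hT hψ.1 hr.1.le hr.2 k).symm
  choose F hF using hlim
  refine ⟨continuousLinearMapOfTendsto (l := 𝓝[<] (1 : ℝ)) (hInftyDilation ψ T)
    (tendsto_pi_nhds.2 hF), fun r hr0 hr => ?_, hF⟩
  exact summable_norm_smul_shift_pow hT (summable_norm_taylorCoeffZero hψ.1 hr0 hr)

theorem isHInftyValue_hInftyCalculus_shift (hT : ∀ n, T (b n) = b (n + 1)) (hψ : MemHInfty ψ) :
    IsHInftyValue ψ T (hInftyCalculus ψ T) := by
  have h := exists_isHInftyValue_shift hT hψ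
  rw [hInftyCalculus, dif_pos h]
  exact h.choose_spec

/-- Summing the eigenvector relation gives the factor `ψ(rw)` for the dilation; as `r → 1` it tends
to `ψ(w)` by continuity inside the disk. -/
theorem inner_szegoKernel_hInftyCalculus (hT : ∀ n, T (b n) = b (n + 1)) (hψ : MemHInfty ψ)
    {w : ℂ} (hw : ‖w‖ < 1) (x : H) :
    ⟪szegoKernel b w, hInftyCalculus ψ T x⟫_ℂ = ψ w * ⟪szegoKernel b w, x⟫_ℂ := by
  have h1 : Tendsto (fun r => ⟪szegoKernel b w, hInftyDilation ψ T r x⟫_ℂ) (𝓝[<] (1 : ℝ))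
      (𝓝 ⟪szegoKernel b w, hInftyCalculus ψ T x⟫_ℂ) :=
    tendsto_const_nhds.inner ((isHInftyValue_hInftyCalculus_shift hT hψ).2 x)
  have hcont : ContinuousAt ψ w :=
    (hψ.1.differentiableAt (Metric.isOpen_ball.mem_nhds (by simpa using hw))).continuousAt
  have hrw : Tendsto (fun r : ℝ => (r : ℂ) * w) (𝓝[<] (1 : ℝ)) (𝓝 w) := by
    have hc : Continuous fun r : ℝ => (r : ℂ) * w := by fun_prop
    simpa using (hc.tendsto 1).mono_left nhdsWithin_le_nhds
  have h2 := (hcont.tendsto.comp hrw).mul_const ⟪szegoKernel b w, x⟫_ℂ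
  refine tendsto_nhds_unique h1 (h2.congr' ?_)
  filter_upwards [Ioo_zero_one_mem_nhdsLT_one] with r hr
  have hrw1 : ‖(r : ℂ) * w‖ < 1 := by
    rw [norm_mul, Complex.norm_real, Real.norm_of_nonneg hr.1.le]
    exact (mul_le_of_le_one_left (norm_nonneg _) hr.2.le).trans_lt hw
  have h3 := ((hasSum_hInftyDilation hT hψ.1 hr.1.le hr.2).mapL
    (ContinuousLinearMap.apply ℂ H x)).mapL (innerSL ℂ (szegoKernel b w))
  have h4 := (hasSum_taylorCoeffZero hψ.1 hrw1).mul_right ⟪szegoKernel b w, x⟫_ℂ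
  refine h4.unique (h3.congr_fun fun n => ?_)
  rw [map_smul, map_smul, ContinuousLinearMap.apply_apply, innerSL_apply_apply, smul_eq_mul,
    inner_szegoKernel_shift_pow hT hw]
  ring

/-- The frame vectors of a unilateral shift are the images of the first basis vector under the
invertible elements of `H^∞`. -/
theorem isFrameVector_shift_iff (hT : ∀ n, T (b n) = b (n + 1)) (f : H) :
    IsFrameVector T f ↔ ∃ ψ : ℂ → ℂ, MemHInfty ψ ∧ (∀ z ∈ Metric.ball (0 : ℂ) 1, ψ z ≠ 0) ∧
      MemHInfty (fun z => 1 / ψ z) ∧ f = hInftyCalculus ψ T (b 0) := by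
  constructor
  · rintro ⟨c₁, c₂, hc₁, hc₂, hf⟩
    -- The only possible symbol: pairing `f = ψ(T) b₀` with `k_w` yields `ψ(w)`, since `⟪k_w, b₀⟫ =
    -- 1`.
    set ψ : ℂ → ℂ := fun w => ⟪szegoKernel b w, f⟫_ℂ with hψdef
    have hbound : ∀ w ∈ Metric.ball (0 : ℂ) 1, c₁ ≤ ‖ψ w‖ ^ 2 ∧ ‖ψ w‖ ^ 2 ≤ c₂ := by
      intro w hw
      rw [mem_ball_zero_iff] at hw
      -- The frame sum at `k_w` factors as `‖k_w‖² |ψ(w)|²`, so cancelling `‖k_w‖²` turns the frame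
      -- bounds into bounds on `|ψ(w)|²`.
      have hsum : HasSum (fun n => ‖⟪szegoKernel b w, (T ^ n) f⟫_ℂ‖ ^ 2)
          (‖szegoKernel b w‖ ^ 2 * ‖ψ w‖ ^ 2) := by
        refine ((b.hasSum_norm_inner_sq (szegoKernel b w)).mul_right _).congr_fun fun n => ?_
        rw [inner_szegoKernel_shift_pow hT hw, norm_mul, mul_pow, norm_inner_symm (b n),
          inner_szegoKernel_basis hw]
      have hpos : 0 < ‖szegoKernel b w‖ ^ 2 := by
        have h0 : szegoKernel b w ≠ 0 := fun h => by
          have := inner_szegoKernel_basis (b := b) hw 0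
          rw [h, inner_zero_left, pow_zero] at this
          exact zero_ne_one this
        positivity
      obtain ⟨-, hlow, hup⟩ := hf (szegoKernel b w)
      rw [hsum.tsum_eq] at hlow hup
      exact ⟨le_of_mul_le_mul_left (by linarith) hpos, le_of_mul_le_mul_left (by linarith) hpos⟩
    have hne : ∀ z ∈ Metric.ball (0 : ℂ) 1, ψ z ≠ 0 := fun z hz h => by
      have := (hbound z hz).1
      rw [h] at this
      simp at this
      linarith
    have hd : DifferentiableOn ℂ ψ (Metric.ball 0 1) := differentiableOn_inner_szegoKernel f
    have hψ : MemHInfty ψ :=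
      ⟨hd, √c₂, fun z hz => Real.le_sqrt_of_sq_le (hbound z hz).2⟩
    refine ⟨ψ, hψ, hne, ⟨?_, 1 / √c₁, fun z hz => ?_⟩, ?_⟩
    · exact (differentiableOn_const 1).div hd hne
    · rw [norm_div, norm_one]
      have h1 : 0 < √c₁ := Real.sqrt_pos.2 hc₁
      gcongr
      exact Real.sqrt_le_iff.2 ⟨norm_nonneg _, (hbound z hz).1⟩
    · refine ext_inner_szegoKernel (b := b) fun w hw => ?_
      rw [inner_szegoKernel_hInftyCalculus hT hψ hw, inner_szegoKernel_basis hw, pow_zero, mul_one]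
  · rintro ⟨ψ, hψ, hne, hφ, rfl⟩
    set A := hInftyCalculus ψ T with hA
    set B := hInftyCalculus (fun z => 1 / ψ z) T with hB
    have hAB : A * B = 1 := by
      ext x
      refine ext_inner_szegoKernel (b := b) fun w hw => ?_
      rw [mul_apply_eq_comp, inner_szegoKernel_hInftyCalculus hT hψ hw,
        inner_szegoKernel_hInftyCalculus hT hφ hw, ← mul_assoc,
        mul_one_div_cancel (hne w (by simpa using hw)), one_mul, one_apply_eq_self]
    have horbit : ∀ n, (T ^ n) (A (b 0)) = A (b n) := fun n => by
      refine ext_inner_szegoKernel (b := b) fun w hw => ?_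
      rw [inner_szegoKernel_shift_pow hT hw, inner_szegoKernel_hInftyCalculus hT hψ hw,
        inner_szegoKernel_hInftyCalculus hT hψ hw, inner_szegoKernel_basis hw,
        inner_szegoKernel_basis hw]
      ring
    -- The orbit is `A bₙ`, so Parseval evaluates the frame sum as `‖A* x‖²`. The upper bound is
    -- boundedness of `A*`, the lower one comes from its left inverse `B*`.
    have hsum : ∀ x : H, HasSum (fun n => ‖⟪x, (T ^ n) (A (b 0))⟫_ℂ‖ ^ 2)
        (‖ContinuousLinearMap.adjoint A x‖ ^ 2) := fun x => by
      refine (b.hasSum_norm_inner_sq (ContinuousLinearMap.adjoint A x)).congr_fun fun n => ?_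
      rw [horbit, ContinuousLinearMap.adjoint_inner_right, norm_inner_symm]
    have hinv : ∀ x : H,
        ContinuousLinearMap.adjoint B (ContinuousLinearMap.adjoint A x) = x := fun x => by
      refine ext_inner_left ℂ fun y => ?_
      rw [ContinuousLinearMap.adjoint_inner_right, ContinuousLinearMap.adjoint_inner_right,
        ← mul_apply_eq_comp, hAB, one_apply_eq_self]
    -- Adding 1 makes both constants positive without excluding zero norms.
    refine ⟨1 / (‖B‖ ^ 2 + 1), ‖A‖ ^ 2 + 1, by positivity, by positivity, fun x =>
      ⟨(hsum x).summable, ?_, ?_⟩⟩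
    · rw [(hsum x).tsum_eq, div_mul_eq_mul_div, one_mul, div_le_iff₀ (by positivity)]
      have h1 := (ContinuousLinearMap.adjoint B).le_opNorm (ContinuousLinearMap.adjoint A x)
      rw [hinv, LinearIsometryEquiv.norm_map] at h1
      calc ‖x‖ ^ 2 ≤ (‖B‖ * ‖ContinuousLinearMap.adjoint A x‖) ^ 2 := by gcongr
        _ ≤ ‖ContinuousLinearMap.adjoint A x‖ ^ 2 * (‖B‖ ^ 2 + 1) := by
          nlinarith [sq_nonneg ‖ContinuousLinearMap.adjoint A x‖]
    · rw [(hsum x).tsum_eq]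
      have h1 := (ContinuousLinearMap.adjoint A).le_opNorm x
      rw [LinearIsometryEquiv.norm_map] at h1
      calc ‖ContinuousLinearMap.adjoint A x‖ ^ 2 ≤ (‖A‖ * ‖x‖) ^ 2 := by gcongr
        _ ≤ (‖A‖ ^ 2 + 1) * ‖x‖ ^ 2 := by nlinarith [sq_nonneg ‖x‖]

end FunctionalCalculus


/-! ### Monomials in `L²(0,1)` and the moment problem. -/

section Monomials

theorem memLp_monomial (k : ℕ) :
    MemLp (fun x : ℝ => (x : ℂ) ^ k) 2 (volume.restrict (Ioo (0 : ℝ) 1)) := by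
  refine MemLp.of_bound (Continuous.aestronglyMeasurable (by fun_prop)) 1 ?_
  filter_upwards [ae_restrict_mem measurableSet_Ioo] with x hx
  rw [norm_pow, Complex.norm_real, Real.norm_of_nonneg hx.1.le]
  exact pow_le_one₀ hx.1.le hx.2.le

/-- The function `x ↦ xᵏ` in `L²(0,1)`. -/
def monomialUnit (k : ℕ) : L2Unit := (memLp_monomial k).toLp _

theorem coeFn_monomialUnit (k : ℕ) :
    monomialUnit k =ᵐ[volume.restrict (Ioo (0 : ℝ) 1)] fun x : ℝ => (x : ℂ) ^ k :=
  (memLp_monomial k).coeFn_toLp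

theorem monomialUnit_zero : monomialUnit 0 = chiUnit := by
  refine Lp.ext ((coeFn_monomialUnit 0).trans ?_)
  filter_upwards [Lp.coeFn_const 2 (volume.restrict (Ioo (0 : ℝ) 1)) (1 : ℂ)] with x hx
  rw [chiUnit, hx, pow_zero, Function.const_apply]

theorem inner_monomialUnit (k : ℕ) (f : L2Unit) :
    ⟪monomialUnit k, f⟫_ℂ = ∫ x in Ioo (0 : ℝ) 1, (x : ℂ) ^ k * f x := by
  rw [L2.inner_def]
  refine integral_congr_ae ?_
  filter_upwards [coeFn_monomialUnit k] with x hx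
  rw [hx, RCLike.inner_apply, map_pow, Complex.conj_ofReal, mul_comm]

theorem inner_monomialUnit_monomialUnit (j k : ℕ) :
    ⟪monomialUnit j, monomialUnit k⟫_ℂ = 1 / ((j : ℂ) + k + 1) := by
  rw [inner_monomialUnit]
  have h : ∫ x in Ioo (0 : ℝ) 1, (x : ℂ) ^ j * monomialUnit k x =
      ∫ x in Ioo (0 : ℝ) 1, ((x ^ (j + k) : ℝ) : ℂ) := by
    refine integral_congr_ae ?_
    filter_upwards [coeFn_monomialUnit k] with x hx
    rw [hx, ← pow_add, Complex.ofReal_pow]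
  rw [h, integral_complex_ofReal, ← integral_Ioc_eq_integral_Ioo,
    ← intervalIntegral.integral_of_le zero_le_one, integral_pow]
  simp

/-- A square-integrable function on `(0,1)` whose moments of positive order vanish is zero. -/
theorem eq_zero_of_inner_monomialUnit {f : L2Unit}
    (h : ∀ k, 1 ≤ k → ⟪monomialUnit k, f⟫_ℂ = 0) : f = 0 := by
  have hfi : IntegrableOn f (Ioo (0 : ℝ) 1) := (Lp.memLp f).integrable (by norm_num)
  have hbdd : ∀ (g : ℝ → ℂ) (φ : ℝ → ℝ), IntegrableOn g (Ioo (0 : ℝ) 1) → Continuous φ →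
      IntegrableOn (fun x => φ x • g x) (Ioo (0 : ℝ) 1) := fun g φ hg hφ => by
    obtain ⟨C, hC⟩ := isCompact_Icc.exists_bound_of_continuousOn (s := Icc (0 : ℝ) 1)
      hφ.continuousOn
    exact Integrable.bdd_smul hg C hφ.aestronglyMeasurable
      ((ae_restrict_mem measurableSet_Ioo).mono fun x hx => hC x ⟨hx.1.le, hx.2.le⟩)
  -- The positive-order moments of `f` are all the moments of `x f(x)`; that function is shown to
  -- vanish, and `x ≠ 0` is cancelled at the end.
  have hxf : IntegrableOn (fun x : ℝ => x • f x) (Ioo (0 : ℝ) 1) :=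
    hbdd f id hfi continuous_id
  have hpow : ∀ φ : ℝ → ℝ, Continuous φ →
      IntegrableOn (fun x : ℝ => φ x • x • f x) (Ioo (0 : ℝ) 1) := fun φ hφ => hbdd _ φ hxf hφ
  have hpoly : ∀ p : Polynomial ℝ, ∫ x in Ioo (0 : ℝ) 1, p.eval x • x • f x = 0 := by
    intro p
    induction p using Polynomial.induction_on' with
    | add p q hp hq =>
      simp only [Polynomial.eval_add, add_smul]
      rw [integral_add (hpow _ p.continuous) (hpow _ q.continuous), hp, hq, add_zero]
    | monomial n a =>
      have h1 := h (n + 1) (by omega)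
      rw [inner_monomialUnit] at h1
      have h2 : ∀ x : ℝ, (Polynomial.monomial n a).eval x • x • f x =
          (a : ℂ) * ((x : ℂ) ^ (n + 1) * f x) := fun x => by
        simp only [Polynomial.eval_monomial, Complex.real_smul]
        push_cast; ring
      simp only [h2]
      rw [integral_const_mul, h1, mul_zero]
  -- Weierstrass approximation on `[0,1]` passes from polynomials to continuous test functions.
  have hcont : ∀ φ : ℝ → ℝ, Continuous φ → ∫ x in Ioo (0 : ℝ) 1, φ x • x • f x = 0 := by
    intro φ hφ
    rw [← norm_le_zero_iff]
    refine le_of_forall_pos_le_add fun ε hε => ?_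
    set M := ∫ x in Ioo (0 : ℝ) 1, ‖x • f x‖ with hM
    have hM0 : 0 ≤ M := integral_nonneg fun _ => norm_nonneg _
    obtain ⟨p, hp⟩ := exists_polynomial_near_of_continuousOn 0 1 φ hφ.continuousOn
      (ε / (M + 1)) (by positivity)
    have h1 : ∫ x in Ioo (0 : ℝ) 1, φ x • x • f x =
        ∫ x in Ioo (0 : ℝ) 1, (φ x - p.eval x) • x • f x := by
      simp only [sub_smul]
      rw [integral_sub (hpow _ hφ) (hpow _ p.continuous), hpoly, sub_zero]
    rw [h1, zero_add]
    calc ‖∫ x in Ioo (0 : ℝ) 1, (φ x - p.eval x) • x • f x‖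
        ≤ ∫ x in Ioo (0 : ℝ) 1, ε / (M + 1) * ‖x • f x‖ := by
          refine norm_integral_le_of_norm_le (hxf.norm.const_mul _) ?_
          filter_upwards [ae_restrict_mem measurableSet_Ioo] with x hx
          rw [norm_smul, Real.norm_eq_abs, abs_sub_comm]
          gcongr
          exact (hp x ⟨hx.1.le, hx.2.le⟩).le
      _ = ε / (M + 1) * M := by rw [integral_const_mul]
      _ ≤ ε / (M + 1) * (M + 1) := by gcongr; linarith
      _ = ε := by field_simp
  have hae : ∀ᵐ x ∂(volume : Measure ℝ), x ∈ Ioo (0 : ℝ) 1 → x • f x = 0 := by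
    refine isOpen_Ioo.ae_eq_zero_of_integral_contDiff_smul_eq_zero hxf.locallyIntegrableOn
      fun φ hφ _ hsupp => ?_
    rw [← hcont φ hφ.continuous]
    refine (setIntegral_eq_integral_of_forall_compl_eq_zero fun x hx => ?_).symm
    rw [image_eq_zero_of_notMem_tsupport fun hx' => hx (hsupp hx'), zero_smul]
  refine Lp.ext ?_
  filter_upwards [(ae_restrict_iff' measurableSet_Ioo).2 hae, ae_restrict_mem measurableSet_Ioo,
    Lp.coeFn_zero ℂ 2 (volume.restrict (Ioo (0 : ℝ) 1))] with x hx hx0 hz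
  rw [hz, Pi.zero_apply]
  exact (smul_eq_zero.1 hx).resolve_left hx0.1.ne'

theorem ext_inner_monomialUnit {f g : L2Unit}
    (h : ∀ k, 1 ≤ k → ⟪monomialUnit k, f⟫_ℂ = ⟪monomialUnit k, g⟫_ℂ) : f = g :=
  sub_eq_zero.1 (eq_zero_of_inner_monomialUnit fun k hk => by
    rw [inner_sub_right, h k hk, sub_self])

end Monomials

/-! ### `I - H₁*` is a unilateral shift with cyclic vector `χ`. -/

section HardyShift

theorem coeFn_hardyOperator (f : L2Unit) :
    hardyOperator f =ᵐ[volume.restrict (Ioo (0 : ℝ) 1)] hardyAverage f :=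
  (memLp_hardyAverage f).coeFn_toLp

theorem hardyOperator_monomialUnit (k : ℕ) :
    hardyOperator (monomialUnit k) = (1 / ((k : ℂ) + 1)) • monomialUnit k := by
  refine Lp.ext ((coeFn_hardyOperator _).trans ?_)
  have hk := ae_imp_of_ae_restrict (coeFn_monomialUnit k)
  filter_upwards [ae_restrict_mem measurableSet_Ioo, coeFn_monomialUnit k,
    Lp.coeFn_smul (1 / ((k : ℂ) + 1)) (monomialUnit k)] with x hx h1 h2
  have h3 : ∫ t in (0 : ℝ)..x, monomialUnit k t = ∫ t in (0 : ℝ)..x, ((t ^ k : ℝ) : ℂ) := by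
    refine intervalIntegral.integral_congr_ae ?_
    filter_upwards [hk] with t ht htx
    rw [uIoc_of_le hx.1.le] at htx
    rw [ht ⟨htx.1, htx.2.trans_lt hx.2⟩, Complex.ofReal_pow]
  have hx0 : (x : ℂ) ≠ 0 := Complex.ofReal_ne_zero.2 hx.1.ne'
  have hk0 : (k : ℂ) + 1 ≠ 0 := Nat.cast_add_one_ne_zero k
  rw [h2, Pi.smul_apply, h1, hardyAverage, h3, intervalIntegral.integral_ofReal, integral_pow]
  simp only [smul_eq_mul]
  push_cast
  field_simp
  ring

/-- The operator `I - H₁*`. -/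
def hardyShift : L2Unit →L[ℂ] L2Unit := 1 - ContinuousLinearMap.adjoint hardyOperator

theorem inner_hardyShift_left (f g : L2Unit) :
    ⟪hardyShift f, g⟫_ℂ = ⟪f, g - hardyOperator g⟫_ℂ := by
  rw [hardyShift, sub_apply, one_apply_eq_self, inner_sub_left,
    ContinuousLinearMap.adjoint_inner_left, inner_sub_right]

theorem inner_hardyShift_right (f g : L2Unit) :
    ⟪f, hardyShift g⟫_ℂ = ⟪f - hardyOperator f, g⟫_ℂ := by
  rw [← inner_conj_symm, inner_hardyShift_left, inner_conj_symm]

/-- Pairing with `xᵏ` moves the adjoint onto an eigenfunction of `H₁`, leaving a rational identity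
in `j` and `k`. Division by `j` is why only positive powers are used. -/
theorem hardyShift_monomialUnit {j : ℕ} (hj : 1 ≤ j) :
    hardyShift (monomialUnit j) =
      (((j : ℂ) + 1) / j) • monomialUnit j - (1 / (j : ℂ)) • chiUnit := by
  refine ext_inner_monomialUnit fun k _ => ?_
  have hj0 : (j : ℂ) ≠ 0 := Nat.cast_ne_zero.2 (by omega)
  have hk0 : (k : ℂ) + 1 ≠ 0 := Nat.cast_add_one_ne_zero k
  have hjk : (k : ℂ) + j + 1 ≠ 0 := by exact_mod_cast Nat.succ_ne_zero (k + j)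
  rw [inner_hardyShift_right, hardyOperator_monomialUnit, inner_sub_left, inner_sub_right,
    inner_smul_left, inner_smul_right, inner_smul_right, ← monomialUnit_zero,
    inner_monomialUnit_monomialUnit, inner_monomialUnit_monomialUnit]
  simp only [map_div₀, map_add, map_one, Complex.conj_natCast, Nat.cast_zero, add_zero]
  field_simp
  ring

theorem hardyOperator_chiUnit : hardyOperator chiUnit = chiUnit := by
  rw [← monomialUnit_zero, hardyOperator_monomialUnit]
  simp

/-- This is `T* T = I`. Tested against `xᵏ`, it reduces to `T* T xᵏ = xᵏ`: `T*` kills the `χ` term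
of `T xᵏ` and its factor `k/(k+1)` cancels `(k+1)/k`. -/
theorem hardyShift_sub_hardyOperator (f : L2Unit) :
    hardyShift f - hardyOperator (hardyShift f) = f := by
  refine ext_inner_monomialUnit fun k hk => ?_
  have hk0 : (k : ℂ) ≠ 0 := Nat.cast_ne_zero.2 (by omega)
  have hk1 : (k : ℂ) + 1 ≠ 0 := Nat.cast_add_one_ne_zero k
  rw [← inner_hardyShift_left, inner_hardyShift_right]
  congr 1
  rw [hardyShift_monomialUnit hk, map_sub, map_smul, map_smul, hardyOperator_monomialUnit,
    hardyOperator_chiUnit, smul_smul, sub_sub_sub_cancel_right, ← sub_smul]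
  convert one_smul ℂ (monomialUnit k) using 2
  field_simp
  ring

theorem inner_hardyShift_hardyShift (f g : L2Unit) :
    ⟪hardyShift f, hardyShift g⟫_ℂ = ⟪f, g⟫_ℂ := by
  rw [inner_hardyShift_left, hardyShift_sub_hardyOperator]

theorem inner_hardyShift_pow (n : ℕ) (f g : L2Unit) :
    ⟪(hardyShift ^ n) f, (hardyShift ^ n) g⟫_ℂ = ⟪f, g⟫_ℂ := by
  induction n with
  | zero => simp
  | succ n ih =>
    rw [pow_succ', mul_apply_eq_comp, mul_apply_eq_comp, inner_hardyShift_hardyShift, ih]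

theorem norm_hardyShift_pow (n : ℕ) (f : L2Unit) : ‖(hardyShift ^ n) f‖ = ‖f‖ := by
  rw [@norm_eq_sqrt_re_inner ℂ, @norm_eq_sqrt_re_inner ℂ, inner_hardyShift_pow]

theorem inner_chiUnit_hardyShift (f : L2Unit) : ⟪chiUnit, hardyShift f⟫_ℂ = 0 := by
  rw [inner_hardyShift_right, hardyOperator_chiUnit, sub_self, inner_zero_left]

/-- `χ` is a wandering vector: the isometry cancels common powers, and `χ` is orthogonal to the
range of `T`. -/
theorem orthonormal_hardyShift_orbit :
    Orthonormal ℂ fun n : ℕ => (hardyShift ^ n) chiUnit := by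
  have hlt : ∀ m n : ℕ, m < n → ⟪(hardyShift ^ m) chiUnit, (hardyShift ^ n) chiUnit⟫_ℂ = 0 := by
    intro m n hmn
    obtain ⟨k, rfl⟩ := Nat.exists_eq_add_of_lt hmn
    rw [add_assoc, pow_add, mul_apply_eq_comp, inner_hardyShift_pow, pow_succ',
      mul_apply_eq_comp, inner_chiUnit_hardyShift]
  refine ⟨fun n => ?_, fun m n hmn => ?_⟩
  · have h := inner_monomialUnit_monomialUnit 0 0
    rw [monomialUnit_zero, inner_self_eq_norm_sq_to_K] at h
    have h2 : ‖chiUnit‖ ^ 2 = 1 := by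
      have : ((‖chiUnit‖ ^ 2 : ℝ) : ℂ) = 1 := by simpa using h
      exact_mod_cast this
    rw [norm_hardyShift_pow]
    exact (pow_eq_one_iff_of_nonneg (norm_nonneg _) two_ne_zero).1 h2
  · rcases lt_or_gt_of_ne hmn with h | h
    · exact hlt m n h
    · change ⟪_, _⟫_ℂ = 0
      rw [← inner_conj_symm, hlt n m h, map_zero]

/-- With `z = k/(k+1)` one has `xᵏ = χ/(k+1) + z T xᵏ`. If `g` is orthogonal to the orbit, iterating
gives `⟪xᵏ, g⟫ = zⁿ ⟪Tⁿ xᵏ, g⟫`, which tends to zero because `T` is isometric and `z < 1`.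
Completeness of the positive powers finishes. -/
theorem eq_zero_of_inner_hardyShift_orbit {g : L2Unit}
    (h : ∀ n : ℕ, ⟪(hardyShift ^ n) chiUnit, g⟫_ℂ = 0) : g = 0 := by
  refine eq_zero_of_inner_monomialUnit fun k hk => ?_
  have hk0 : (k : ℂ) ≠ 0 := Nat.cast_ne_zero.2 (by omega)
  have hk1 : (k : ℂ) + 1 ≠ 0 := Nat.cast_add_one_ne_zero k
  set z : ℝ := (k : ℝ) / (k + 1) with hz
  have hmono : monomialUnit k = (1 / ((k : ℂ) + 1)) • chiUnit +
      (z : ℂ) • hardyShift (monomialUnit k) := by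
    rw [hardyShift_monomialUnit hk, smul_sub, smul_smul, smul_smul]
    have e1 : (z : ℂ) * (((k : ℂ) + 1) / k) = 1 := by rw [hz]; push_cast; field_simp
    have e2 : (z : ℂ) * (1 / k) = 1 / ((k : ℂ) + 1) := by rw [hz]; push_cast; field_simp
    rw [e1, e2, one_smul]
    abel
  have hstep : ∀ n : ℕ, ⟪monomialUnit k, g⟫_ℂ =
      (z : ℂ) ^ n * ⟪(hardyShift ^ n) (monomialUnit k), g⟫_ℂ := by
    intro n
    induction n with
    | zero => simp
    | succ n ih =>
      rw [ih]
      conv_lhs => rw [hmono]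
      rw [map_add, map_smul, map_smul, ← mul_apply_eq_comp, ← pow_succ, inner_add_left,
        inner_smul_left, inner_smul_left, h n, Complex.conj_ofReal]
      ring
  have hz0 : 0 ≤ z := by positivity
  have hz1 : z < 1 := by rw [hz, div_lt_one (by positivity)]; linarith
  have hlim : Tendsto (fun n : ℕ => z ^ n * (‖monomialUnit k‖ * ‖g‖)) atTop (𝓝 0) := by
    simpa using (tendsto_pow_atTop_nhds_zero_of_lt_one hz0 hz1).mul_const
      (‖monomialUnit k‖ * ‖g‖)
  rw [← norm_le_zero_iff]
  refine ge_of_tendsto' hlim fun n => ?_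
  rw [hstep n, norm_mul, norm_pow, Complex.norm_real, Real.norm_of_nonneg hz0]
  gcongr
  refine (norm_inner_le_norm _ _).trans_eq ?_
  rw [norm_hardyShift_pow]

/-- The orbit of `χ` under `I - H₁*` is an orthonormal basis, so that `I - H₁*` is a unilateral
shift of multiplicity one. -/
def hardyShiftBasis : HilbertBasis ℕ ℂ L2Unit :=
  HilbertBasis.mkOfOrthogonalEqBot orthonormal_hardyShift_orbit (by
    rw [Submodule.eq_bot_iff]
    intro g hg
    exact eq_zero_of_inner_hardyShift_orbit fun n =>
      (Submodule.mem_orthogonal _ _).1 hg _ (Submodule.subset_span ⟨n, rfl⟩))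

theorem hardyShiftBasis_apply (n : ℕ) : hardyShiftBasis n = (hardyShift ^ n) chiUnit :=
  congrFun (HilbertBasis.coe_mkOfOrthogonalEqBot _ _) n

theorem hardyShift_hardyShiftBasis (n : ℕ) :
    hardyShift (hardyShiftBasis n) = hardyShiftBasis (n + 1) := by
  rw [hardyShiftBasis_apply, hardyShiftBasis_apply, pow_succ', mul_apply_eq_comp]

end HardyShift

end

theorem mainTheorem9 :
    (∀ ψ : ℂ → ℂ, MemHInfty ψ →
      IsHInftyValue ψ (1 - ContinuousLinearMap.adjoint hardyOperator)
        (hInftyCalculus ψ (1 - ContinuousLinearMap.adjoint hardyOperator))) ∧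
    ∀ f : L2Unit,
      IsFrameVector (1 - ContinuousLinearMap.adjoint hardyOperator) f ↔
        ∃ ψ : ℂ → ℂ, MemHInfty ψ ∧ (∀ z ∈ Metric.ball (0 : ℂ) 1, ψ z ≠ 0) ∧
          MemHInfty (fun z => 1 / ψ z) ∧
          f = hInftyCalculus ψ (1 - ContinuousLinearMap.adjoint hardyOperator) chiUnit := by
  have h0 : hardyShiftBasis 0 = chiUnit := by rw [hardyShiftBasis_apply]; simp
  refine ⟨fun ψ hψ => isHInftyValue_hInftyCalculus_shift hardyShift_hardyShiftBasis hψ,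
    fun f => ?_⟩
  rw [← h0]
  exact isFrameVector_shift_iff hardyShift_hardyShiftBasis f
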